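/- A permutation of length $n\ge 1$ is a sequence $\sigma=\sigma(1)\ldots\sigma(n)$ containing each of $1,\dots,n$ exactly once. The standardization $\operatorname{st}[s]$ of a sequence $s$ of distinct integers is the permutation of the same length with the same relative order of entries. An occurrence of a permutation $\pi$ of length $l$ in $\sigma$ is a position $1\le i\le n-l+1$ with $\operatorname{st}[\sigma(i)\ldots\sigma(i+l-1)]=\pi$; $\pi$ divides $\sigma$ if it has an occurrence in $\sigma$. A collection of patterns is a (finite or infinite) set of permutations; it is reduced if none of its members divides a different member. A linkage of an ordered pair $(\pi,\pi')$ of (possibly equal) permutations of lengths $l,l'$ is a permutation $\sigma$ of some length $n$ with $\max(l,l')\le n<l+l'$, $\operatorname{st}[\sigma(1)\ldots\sigma(l)]=\pi$ and $\operatorname{st}[\sigma(n-l'+1)\ldots\sigma(n)]=\pi'$. Theorem 1.3. Let $\Pi_1$ and $\Pi_2$ be reduced collections of patterns, and suppose that there is a bijection $\varphi:\Pi_1\to\Pi_2$ with the following three properties. - (lengths) For every $\pi\in\Pi_1$, the length of $\varphi(\pi)$ equals the length of $\pi$. - (linkages) For all $\pi,\pi'\in\Pi_1$ and all $n$, the pair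 $(\pi,\pi')$ has a linkage of length $n$ if and only if $(\varphi(\pi),\varphi(\pi'))$ has a linkage of length $n$. - (overlapping sets) For all $\pi,\pi'\in\Pi_1$ of lengths $l,l'$ and every integer $1\le k\le\min(l,l')$ with $\operatorname{st}[\pi(l-k+1)\ldots\pi(l)]=\operatorname{st}[\pi'(1)\ldots\pi'(k)]$, one has the equalities of unordered sets $$\{\pi(l-k+1),\ldots,\pi(l)\}=\{\varphi(\pi)(l-k+1),\ldots,\varphi(\pi)(l)\},\qquad \{\pi'(1),\ldots,\pi'(k)\}=\{\varphi(\pi')(1),\ldots,\varphi(\pi')(k)\}.$$ Then $\Pi_1$ and $\Pi_2$ are strongly c-Wilf equivalent: for all integers $n\ge 1$ and $q\ge 0$, the number of permutations of length $n$ with exactly $q$ occurrences of patterns from $\Pi_1$ (counting pairs of a pattern and an occurrence of it) equals the number of permutations of length $n$ with exactly $q$ occurrences of patterns from $\Pi_2$. -/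

import Mathlib

namespace CWilf

/-- A permutation together with its length. Positions and values are numbered from `0`
instead of `1`: the one-line notation is `σ.2 0, …, σ.2 (n - 1)`. -/
abbrev Word : Type := (n : ℕ) × Equiv.Perm (Fin n)

/-- The length of a permutation. -/
abbrev Word.length (σ : Word) : ℕ := σ.1

/-- The standardization of a sequence `s` of `l` distinct elements of a linear order: `st s i` is
the rank of `s i` among the entries of `s`. (`Tuple.sort s` lists the positions in increasing order
of their entries.) See `st_lt_st_iff` and `st_eq_iff` for the defining property. -/
def st {α : Type*} [LinearOrder α] {l : ℕ} (s : Fin l → α) : Equiv.Perm (Fin l) :=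
  (Tuple.sort s)⁻¹

theorem st_lt_st_iff {α : Type*} [LinearOrder α] {l : ℕ} {s : Fin l → α}
    (hs : Function.Injective s) (i j : Fin l) : st s i < st s j ↔ s i < s j := by
  have hm : StrictMono (s ∘ Tuple.sort s) :=
    (Tuple.monotone_sort s).strictMono_of_injective (hs.comp (Tuple.sort s).injective)
  have h := hm.lt_iff_lt (a := st s i) (b := st s j)
  simpa [st] using h.symm

/-- `st s` is the unique permutation with the same relative order as `s`. -/
theorem st_eq_iff {α : Type*} [LinearOrder α] {l : ℕ} {s : Fin l → α}
    (hs : Function.Injective s) (π : Equiv.Perm (Fin l)) :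
    st s = π ↔ ∀ i j, s i < s j ↔ π i < π j := by
  constructor
  · rintro rfl i j
    exact (st_lt_st_iff hs i j).symm
  · intro h
    have hm : StrictMono (π ∘ (st s).symm) := by
      intro a b hab
      have : st s ((st s).symm a) < st s ((st s).symm b) := by simpa using hab
      exact (h _ _).1 ((st_lt_st_iff hs _ _).1 this)
    have hid : (π ∘ (st s).symm) = id := by
      have hr : Set.range (π ∘ (st s).symm) = Set.range (id : Fin l → Fin l) := by
        rw [Set.range_id, ((π.surjective).comp (st s).symm.surjective).range_eq]
      exact (StrictMono.range_inj hm strictMono_id).1 hr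
    ext i
    have := congrFun hid (st s i)
    simp only [Function.comp_apply, Equiv.symm_apply_apply, id] at this
    rw [this]

/-- The subword of `σ` consisting of the `k` consecutive entries at positions `i, …, i + k - 1`. -/
def Word.subword (σ : Word) (i k : ℕ) (h : i + k ≤ σ.length) : Fin k → Fin σ.length :=
  fun j => σ.2 ⟨i + j, (Nat.add_lt_add_left j.isLt i).trans_le h⟩

/-- `π` occurs in `σ` as a consecutive pattern, starting at position `i`. -/
def OccursAt (π σ : Word) (i : ℕ) : Prop :=
  ∃ h : i + π.length ≤ σ.length, st (σ.subword i π.length h) = π.2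

/-- `π` divides `σ`: `σ` contains `π` as a consecutive pattern. -/
def Divides (π σ : Word) : Prop := ∃ i, OccursAt π σ i

/-- A collection of patterns is reduced if none of its members divides another one. -/
def IsReduced (A : Set Word) : Prop :=
  ∀ π ∈ A, ∀ π' ∈ A, π ≠ π' → ¬ Divides π π'

/-- `σ` is a linkage of the ordered pair `(π, π')`: it is shorter than the two patterns
together, begins with `π` and ends with `π'`. (If `π'` is longer than `σ` the last clause
fails, so the subtraction is never truncated in a linkage.) -/
def IsLinkage (σ π π' : Word) : Prop :=
  σ.length < π.length + π'.length ∧ OccursAt π σ 0 ∧ OccursAt π' σ (σ.length - π'.length)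

/-- The pair `(π, π')` `k`-overlaps: the last `k` entries of `π` and the first `k` entries of `π'`
have the same standardization, where `1 ≤ k ≤ min (length π) (length π')`. -/
def Overlaps (k : ℕ) (π π' : Word) : Prop :=
  0 < k ∧ ∃ (h : k ≤ π.length) (h' : k ≤ π'.length),
    st (π.subword (π.length - k) k (by omega)) = st (π'.subword 0 k (by omega))

/-- The unordered set of the first `k` entries. -/
def firstEntries (π : Word) (k : ℕ) : Set ℕ :=
  (fun p : Fin π.length => (π.2 p : ℕ)) '' {p | (p : ℕ) < k}

/-- The unordered set of the last `k` entries. -/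
def lastEntries (π : Word) (k : ℕ) : Set ℕ :=
  (fun p : Fin π.length => (π.2 p : ℕ)) '' {p | π.length ≤ (p : ℕ) + k}

/-- The number of consecutive occurrences in `σ` of patterns from `A`, i.e. of pairs of a
pattern and a starting position. -/
noncomputable def occurrences (A : Set Word) (σ : Word) : ℕ :=
  {x : Word × ℕ | x.1 ∈ A ∧ OccursAt x.1 σ x.2}.ncard

/-- The set counted by `occurrences` is always finite, even if `A` is infinite. -/
theorem finite_occurrences (A : Set Word) (σ : Word) :
    {x : Word × ℕ | x.1 ∈ A ∧ OccursAt x.1 σ x.2}.Finite := by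
  let f : ((l : Fin (σ.length + 1)) × Equiv.Perm (Fin l)) × Fin (σ.length + 1) → Word × ℕ :=
    fun y => (⟨y.1.1, y.1.2⟩, y.2)
  refine (Set.finite_range f).subset ?_
  rintro ⟨⟨l, π⟩, i⟩ ⟨-, h, -⟩
  have h' : i + l ≤ σ.length := h
  exact ⟨(⟨⟨l, by omega⟩, π⟩, ⟨i, by omega⟩), rfl⟩

/-- The number of permutations of length `n` with exactly `q` consecutive occurrences of
patterns from `A`. -/
noncomputable def countWith (A : Set Word) (n q : ℕ) : ℕ :=
  Nat.card {σ : Equiv.Perm (Fin n) // occurrences A ⟨n, σ⟩ = q}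

/-- Strong c-Wilf equivalence of two collections of patterns. -/
def StronglyCWilfEquivalent (A B : Set Word) : Prop :=
  ∀ n q : ℕ, 0 < n → countWith A n q = countWith B n q

end CWilf

namespace CWilf

/-! Mark `m` occurrences in a permutation: the number of marked permutations of length `n` is the
sum of `(occurrences A σ).choose m`, and these sums over all `m` determine the distribution
(`card_eq_of_sum_choose_eq`). It therefore suffices to match marked permutations for the two
collections. Inside each marked occurrence of a pattern of the first collection, permute the entries
so that they form its partner. Where two marked occurrences meet, both prescribe the same
rearrangement (`add_transfer_eq`): the overlap keeps its set of entries, and a linkage of the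
partners of the same length forces a common relative order there. Nested occurrences cannot conflict
because the collection is reduced. The rearrangement is injective for fixed marks, which gives an
inequality (`Compatible.sum_choose_le`); the roles of the collections are symmetric, so equality
follows. -/

theorem Word.subword_injective (σ : Word) (i k : ℕ) (h : i + k ≤ σ.length) :
    Function.Injective (σ.subword i k h) := by
  intro u v huv
  have := σ.2.injective huv
  simp only [Fin.mk.injEq] at this
  exact Fin.ext (by omega)

theorem occursAt_iff {π σ : Word} {i : ℕ} :
    OccursAt π σ i ↔ ∃ h : i + π.length ≤ σ.length, ∀ u v : Fin π.length,
      σ.subword i π.length h u < σ.subword i π.length h v ↔ π.2 u < π.2 v := by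
  constructor
  · rintro ⟨h, hs⟩
    exact ⟨h, (st_eq_iff (σ.subword_injective _ _ _) _).1 hs⟩
  · rintro ⟨h, hs⟩
    exact ⟨h, (st_eq_iff (σ.subword_injective _ _ _) _).2 hs⟩

/-- The order of two entries of `σ`, read off an occurrence of `π`. -/
theorem OccursAt.lt_iff {π σ : Word} {i : ℕ} (h : OccursAt π σ i) {x y : Fin σ.length}
    {u v : Fin π.length} (hx : (x : ℕ) = i + u) (hy : (y : ℕ) = i + v) :
    σ.2 x < σ.2 y ↔ π.2 u < π.2 v := by
  obtain ⟨h, hs⟩ := occursAt_iff.1 h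
  rw [← hs u v]
  have hx' : x = ⟨i + u, (Nat.add_lt_add_left u.isLt i).trans_le h⟩ := Fin.ext hx
  have hy' : y = ⟨i + v, (Nat.add_lt_add_left v.isLt i).trans_le h⟩ := Fin.ext hy
  rw [hx', hy']
  rfl

theorem OccursAt.add_le {π σ : Word} {i : ℕ} (h : OccursAt π σ i) :
    i + π.length ≤ σ.length := h.1

/-- If `ρ` occurs in `σ` and its interval of positions contains that of an occurrence of `π`, then
`π` occurs in `ρ`. -/
theorem OccursAt.of_nested {π ρ σ : Word} {p q : ℕ} (hπ : OccursAt π σ p) (hρ : OccursAt ρ σ q)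
    (hqp : q ≤ p) (hend : p + π.length ≤ q + ρ.length) : OccursAt π ρ (p - q) := by
  have hle := hρ.add_le
  refine occursAt_iff.2 ⟨by omega, fun u v => ?_⟩
  have hu := u.isLt
  have hv := v.isLt
  rw [← hπ.lt_iff (x := ⟨p + u, by omega⟩) (y := ⟨p + v, by omega⟩) rfl rfl]
  exact (hρ.lt_iff (by simp only; omega) (by simp only; omega)).symm

/-- The factor of `σ` at positions `p, …, p + k - 1`. -/
def Word.factor (σ : Word) (p k : ℕ) (h : p + k ≤ σ.length) : Word := ⟨k, st (σ.subword p k h)⟩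

theorem Word.factor_occursAt (σ : Word) (p k : ℕ) (h : p + k ≤ σ.length) :
    OccursAt (σ.factor p k h) σ p := ⟨h, rfl⟩

/-- Two occurrences in `σ` with overlapping, not nested intervals of positions give a linkage. -/
theorem exists_isLinkage {π π' σ : Word} {p q : ℕ} (hπ : OccursAt π σ p) (hπ' : OccursAt π' σ q)
    (hpq : p ≤ q) (hlt : q < p + π.length) (hend : p + π.length ≤ q + π'.length) :
    ∃ ω : Word, ω.length = q + π'.length - p ∧ IsLinkage ω π π' := by
  have hle := hπ'.add_le
  have hω := σ.factor_occursAt p (q + π'.length - p) (by omega)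
  refine ⟨σ.factor p (q + π'.length - p) (by omega), rfl, ?_, ?_, ?_⟩
  · change q + π'.length - p < _
    omega
  · have h := hπ.of_nested hω le_rfl
      (show p + π.length ≤ p + (q + π'.length - p) by omega)
    rwa [Nat.sub_self] at h
  · have h := hπ'.of_nested hω hpq
      (show q + π'.length ≤ p + (q + π'.length - p) by omega)
    convert h using 1
    simp only [Word.factor, Word.length] at *
    omega

/-! ### Agreement of two rearrangements on an overlap -/

/-- An arrangement of the entries of a sequence is determined by its relative order. -/
theorem eq_of_lt_iff_lt {α β : Type*} [LinearOrder α] [LinearOrder β] {k : ℕ} {s : Fin k → α}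
    {t : Fin k → β} (hs : Function.Injective s) (ht : Function.Injective t)
    {f g : Fin k → Fin k} (hf : Function.Injective f) (hg : Function.Injective g)
    (hsf : ∀ x y, s (f x) < s (f y) ↔ t x < t y) (hsg : ∀ x y, s (g x) < s (g y) ↔ t x < t y) :
    f = g := by
  have key : ∀ e : Fin k → Fin k, Function.Injective e →
      (∀ x y, s (e x) < s (e y) ↔ t x < t y) → ∀ x, st t x = st s (e x) := by
    intro e he h x
    have := (st_eq_iff ht ((Equiv.ofBijective e (Finite.injective_iff_bijective.1 he)).trans
      (st s))).2 fun i j => by simp [st_lt_st_iff hs, h]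
    rw [this]
    rfl
  funext x
  exact (st s).injective ((key f hf hsf x).symm.trans (key g hg hsg x))

theorem mem_lastEntries_iff {l k : ℕ} {π : Equiv.Perm (Fin l)} (u : Fin l) :
    ((π u : Fin l) : ℕ) ∈ lastEntries ⟨l, π⟩ k ↔ l ≤ u + k := by
  constructor
  · rintro ⟨w, hw, h⟩
    have : w = u := π.injective (Fin.ext h)
    exact this ▸ hw
  · exact fun h => ⟨u, h, rfl⟩

theorem mem_firstEntries_iff {l k : ℕ} {π : Equiv.Perm (Fin l)} (u : Fin l) :
    ((π u : Fin l) : ℕ) ∈ firstEntries ⟨l, π⟩ k ↔ (u : ℕ) < k := by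
  constructor
  · rintro ⟨w, hw, h⟩
    have : w = u := π.injective (Fin.ext h)
    exact this ▸ hw
  · exact fun h => ⟨u, h, rfl⟩

/-- The position in `π` of the entry that `ρ` has at position `u`. -/
def transfer {l : ℕ} (π ρ : Equiv.Perm (Fin l)) : Equiv.Perm (Fin l) := ρ.trans π.symm

@[simp]
theorem apply_transfer {l : ℕ} (π ρ : Equiv.Perm (Fin l)) (u : Fin l) :
    π (transfer π ρ u) = ρ u := by simp [transfer]

/-- Equality of the entry sets makes the transfer preserve the block of overlapping positions. -/
theorem le_transfer_iff {l k : ℕ} {π ρ : Equiv.Perm (Fin l)}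
    (h : lastEntries ⟨l, π⟩ k = lastEntries ⟨l, ρ⟩ k) (u : Fin l) :
    l ≤ transfer π ρ u + k ↔ l ≤ u + k := by
  rw [← mem_lastEntries_iff (π := π), ← mem_lastEntries_iff (π := ρ), apply_transfer, h]

theorem transfer_lt_iff {l k : ℕ} {π ρ : Equiv.Perm (Fin l)}
    (h : firstEntries ⟨l, π⟩ k = firstEntries ⟨l, ρ⟩ k) (u : Fin l) :
    (transfer π ρ u : ℕ) < k ↔ (u : ℕ) < k := by
  rw [← mem_firstEntries_iff (π := π), ← mem_firstEntries_iff (π := ρ), apply_transfer, h]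

/-- The two transfer maps of two overlapping occurrences agree on the overlap. -/
theorem add_transfer_eq {l l' p q n : ℕ} {π ρ : Equiv.Perm (Fin l)} {π' ρ' : Equiv.Perm (Fin l')}
    {σ ω : Word} (hend : p + l ≤ q + l') (hpq : p ≤ q)
    (hn : n = p + l - q)
    (hπ : OccursAt ⟨l, π⟩ σ p) (hπ' : OccursAt ⟨l', π'⟩ σ q)
    (hω : ω.length = q + l' - p) (hlink : IsLinkage ω ⟨l, ρ⟩ ⟨l', ρ'⟩)
    (hlast : lastEntries ⟨l, π⟩ n = lastEntries ⟨l, ρ⟩ n)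
    (hfirst : firstEntries ⟨l', π'⟩ n = firstEntries ⟨l', ρ'⟩ n)
    (u : Fin l) (v : Fin l') (huv : p + u = q + v) :
    p + (transfer π ρ u : ℕ) = q + transfer π' ρ' v := by
  have hσ := hπ'.add_le
  obtain ⟨-, hρ, hρ'⟩ := hlink
  simp only [Word.length] at hσ hω hρ'
  have hpos : ω.1 - l' = q - p := by omega
  rw [hpos] at hρ'
  -- `c` and `d` view the `n` shared positions as the end of the left pattern and the start of the
  -- right one.
  let c : Fin n → Fin l := fun x => ⟨q - p + x, by omega⟩
  let d : Fin n → Fin l' := fun x => ⟨x, by omega⟩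
  have hc : Function.Injective c := fun x y h => by
    simp only [c, Fin.mk.injEq] at h
    exact Fin.ext (by omega)
  have hd : Function.Injective d := fun x y h => by
    simp only [d, Fin.mk.injEq] at h
    exact Fin.ext h
  have hσlt : ∀ x y, π (c x) < π (c y) ↔ π' (d x) < π' (d y) := fun x y => by
    have h1 := hπ.lt_iff (x := ⟨q + x, by simp only [Word.length]; omega⟩)
      (y := ⟨q + y, by simp only [Word.length]; omega⟩) (u := c x) (v := c y)
      (by simp only [c]; omega) (by simp only [c]; omega)
    exact h1.symm.trans (hπ'.lt_iff rfl rfl)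
  have hωlt : ∀ x y, ρ (c x) < ρ (c y) ↔ ρ' (d x) < ρ' (d y) := fun x y => by
    have h1 := hρ.lt_iff (x := ⟨q - p + x, by simp only [Word.length]; omega⟩)
      (y := ⟨q - p + y, by simp only [Word.length]; omega⟩) (u := c x) (v := c y)
      (by simp only [c]; omega) (by simp only [c]; omega)
    exact h1.symm.trans (hρ'.lt_iff rfl rfl)
  have hcle : ∀ x, l ≤ transfer π ρ (c x) + n := fun x =>
    (le_transfer_iff hlast _).2 (by simp only [c]; omega)
  let f : Fin n → Fin n := fun x => ⟨transfer π ρ (c x) - (q - p), by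
    have := (transfer π ρ (c x)).isLt; have := x.isLt; omega⟩
  let g : Fin n → Fin n := fun x => ⟨transfer π' ρ' (d x), (transfer_lt_iff hfirst _).2 x.isLt⟩
  have hcf : ∀ x, c (f x) = transfer π ρ (c x) := fun x => Fin.ext (by
    have := hcle x; have := x.isLt; simp only [c, f] at *; omega)
  have hdg : ∀ x, d (g x) = transfer π' ρ' (d x) := fun x => rfl
  have hf : Function.Injective f := fun x y h => by
    have h' := congrArg c h
    rw [hcf, hcf] at h'
    exact hc ((transfer π ρ).injective h')
  have hg : Function.Injective g := fun x y h => by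
    have h' := congrArg d h
    rw [hdg, hdg] at h'
    exact hd ((transfer π' ρ').injective h')
  -- On the overlap, `σ` identifies the orders of `π` and `π'`, and `ω` those of `ρ` and `ρ'`. So
  -- `f` and `g` both rearrange the entries of `π` there into the order of `ρ`.
  have hfg : f = g := by
    refine eq_of_lt_iff_lt (s := fun x => π (c x)) (t := fun x => ρ (c x))
      (π.injective.comp hc) (ρ.injective.comp hc) hf hg (fun x y => ?_) (fun x y => ?_)
    · simp only [hcf, apply_transfer]
    · rw [hσlt, hωlt]
      simp only [hdg, apply_transfer]
  have hvn : (v : ℕ) < n := by have := u.isLt; omega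
  have hu : c ⟨v, hvn⟩ = u := Fin.ext (by simp only [c]; omega)
  have hv : d ⟨v, hvn⟩ = v := rfl
  have h1 := hcf ⟨v, hvn⟩
  have h2 := hdg ⟨v, hvn⟩
  rw [hu] at h1
  rw [hv] at h2
  rw [← h1, ← h2, hfg]
  simp only [c, d]
  omega

/-! ### Rearranging all marked occurrences at once -/

section Families

variable {ι : Type*} {l : ι → ℕ}

/-- Two families of patterns of the same lengths, the first of which is reduced, have compatible
linkages: those of the first family are, as far as lengths go, linkages of the second one,
and the sets of overlapping entries agree. -/
structure Compatible (a b : (i : ι) → Equiv.Perm (Fin (l i))) : Prop where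
  reduced : ∀ i j, Divides ⟨l i, a i⟩ ⟨l j, a j⟩ → i = j
  linkage : ∀ i j (ω : Word), IsLinkage ω ⟨l i, a i⟩ ⟨l j, a j⟩ →
    ∃ ω' : Word, ω'.length = ω.length ∧ IsLinkage ω' ⟨l i, b i⟩ ⟨l j, b j⟩
  last : ∀ i j (ω : Word), IsLinkage ω ⟨l i, a i⟩ ⟨l j, a j⟩ →
    lastEntries ⟨l i, a i⟩ (l i + l j - ω.length) = lastEntries ⟨l i, b i⟩ (l i + l j - ω.length)
  first : ∀ i j (ω : Word), IsLinkage ω ⟨l i, a i⟩ ⟨l j, a j⟩ →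
    firstEntries ⟨l j, a j⟩ (l i + l j - ω.length) = firstEntries ⟨l j, b j⟩ (l i + l j - ω.length)

variable {a b : (i : ι) → Equiv.Perm (Fin (l i))}

theorem Compatible.eq_of_nested (h : Compatible a b) {σ : Word} {i j : ι} {p q : ℕ}
    (hi : OccursAt ⟨l i, a i⟩ σ p) (hj : OccursAt ⟨l j, a j⟩ σ q) (hqp : q ≤ p)
    (hend : p + l i ≤ q + l j) : i = j ∧ p = q := by
  obtain rfl := h.reduced i j ⟨_, hi.of_nested hj hqp hend⟩
  exact ⟨rfl, by omega⟩

theorem Compatible.add_transfer_eq (h : Compatible a b) {σ : Word} {i j : ι} {p q : ℕ}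
    (hi : OccursAt ⟨l i, a i⟩ σ p) (hj : OccursAt ⟨l j, a j⟩ σ q) (u : Fin (l i)) (v : Fin (l j))
    (huv : p + u = q + v) :
    p + (transfer (a i) (b i) u : ℕ) = q + transfer (a j) (b j) v := by
  wlog hpq : p ≤ q generalizing i j p q
  · exact (this hj hi v u huv.symm (by omega)).symm
  by_cases hend : p + l i ≤ q + l j
  · have hu := u.isLt
    obtain ⟨ω, hω, hlink⟩ := exists_isLinkage hi hj hpq (by simp only [Word.length]; omega) hend
    obtain ⟨ω', hω', hlink'⟩ := h.linkage i j ω hlink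
    have hn : l i + l j - ω.length = p + l i - q := by simp only [Word.length] at *; omega
    exact CWilf.add_transfer_eq hend hpq hn hi hj (hω'.trans hω) hlink' (h.last i j ω hlink)
      (h.first i j ω hlink) u v huv
  -- The right interval lies inside the left one, so the two occurrences coincide.
  · obtain ⟨rfl, rfl⟩ := h.eq_of_nested hj hi hpq (by omega)
    have : u = v := Fin.ext (by omega)
    rw [this]

/-- `σ` is rearranged to `σ'` by changing the marked occurrences of members of the
family `a` into occurrences of the corresponding members of `b`. -/
def Rearranged (a b : (i : ι) → Equiv.Perm (Fin (l i))) {n : ℕ} (S : Finset (ι × ℕ))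
    (σ σ' : Equiv.Perm (Fin n)) : Prop :=
  (∀ y ∈ S, ∀ u : Fin (l y.1), ∀ x z : Fin n, (x : ℕ) = y.2 + u →
    (z : ℕ) = y.2 + transfer (a y.1) (b y.1) u → σ' x = σ z) ∧
  ∀ x : Fin n, (∀ y ∈ S, ∀ u : Fin (l y.1), (x : ℕ) ≠ y.2 + u) → σ' x = σ x

/-- Each transfer is a bijection of its interval, so every entry of the original can be read off
from `σ'` and the marks. -/
theorem Rearranged.left_unique {n : ℕ} {S : Finset (ι × ℕ)} {σ₁ σ₂ σ' : Equiv.Perm (Fin n)}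
    (hS : ∀ y ∈ S, y.2 + l y.1 ≤ n) (h₁ : Rearranged a b S σ₁ σ') (h₂ : Rearranged a b S σ₂ σ') :
    σ₁ = σ₂ := by
  ext1 x
  by_cases hx : ∃ y ∈ S, ∃ u : Fin (l y.1), (x : ℕ) = y.2 + u
  · obtain ⟨y, hy, u, hu⟩ := hx
    have hle := hS y hy
    obtain ⟨w, rfl⟩ := (transfer (a y.1) (b y.1)).surjective u
    have hw := w.isLt
    rw [← h₁.1 y hy w ⟨y.2 + w, by omega⟩ x rfl hu, ← h₂.1 y hy w ⟨y.2 + w, by omega⟩ x rfl hu]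
  · push Not at hx
    rw [← h₁.2 x hx, ← h₂.2 x hx]

theorem Compatible.exists_rearranged (h : Compatible a b) {n : ℕ} {S : Finset (ι × ℕ)}
    {σ : Equiv.Perm (Fin n)} (hS : ∀ y ∈ S, OccursAt ⟨l y.1, a y.1⟩ ⟨n, σ⟩ y.2) :
    ∃ σ' : Equiv.Perm (Fin n), (∀ y ∈ S, OccursAt ⟨l y.1, b y.1⟩ ⟨n, σ'⟩ y.2) ∧
      Rearranged a b S σ σ' := by
  have hle : ∀ y ∈ S, y.2 + l y.1 ≤ n := fun y hy => (hS y hy).add_le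
  -- `z` is the position that supplies the new entry at `x`; it does not depend on which marked
  -- occurrence covers `x`.
  have hT : ∀ x : Fin n, ∃ z : Fin n,
      (∀ y ∈ S, ∀ u : Fin (l y.1), (x : ℕ) = y.2 + u →
        (z : ℕ) = y.2 + transfer (a y.1) (b y.1) u) ∧
      ((∀ y ∈ S, ∀ u : Fin (l y.1), (x : ℕ) ≠ y.2 + u) → z = x) := by
    intro x
    by_cases hx : ∃ y ∈ S, ∃ u : Fin (l y.1), (x : ℕ) = y.2 + u
    · obtain ⟨y, hy, u, hu⟩ := hx
      have hy' := hle y hy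
      refine ⟨⟨y.2 + transfer (a y.1) (b y.1) u, by omega⟩, fun y' hy' v hv => ?_,
        fun hn => absurd hu (hn y hy u)⟩
      exact h.add_transfer_eq (hS y hy) (hS y' hy') u v (hu.symm.trans hv)
    · push Not at hx
      exact ⟨x, fun y hy u hu => absurd hu (hx y hy u), fun _ => rfl⟩
  choose T hT hT' using hT
  have hsurj : Function.Surjective T := by
    intro z
    by_cases hz : ∃ y ∈ S, ∃ u : Fin (l y.1), (z : ℕ) = y.2 + u
    · obtain ⟨y, hy, u, hu⟩ := hz
      obtain ⟨w, rfl⟩ := (transfer (a y.1) (b y.1)).surjective u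
      have hy' := hle y hy
      exact ⟨⟨y.2 + w, by omega⟩, Fin.ext ((hT _ y hy w rfl).trans hu.symm)⟩
    · push Not at hz
      exact ⟨z, hT' z hz⟩
  let e : Equiv.Perm (Fin n) := Equiv.ofBijective T (Finite.surjective_iff_bijective.1 hsurj)
  refine ⟨e.trans σ, fun y hy => ?_, fun y hy u x z hx hz => ?_, fun x hx => ?_⟩
  · refine occursAt_iff.2 ⟨hle y hy, fun u v => ?_⟩
    have hy' := hle y hy
    have hu : (u : ℕ) < l y.1 := u.isLt
    have hv : (v : ℕ) < l y.1 := v.isLt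
    have := (hS y hy).lt_iff (hT ⟨y.2 + u, by omega⟩ y hy u rfl)
      (hT ⟨y.2 + v, by omega⟩ y hy v rfl)
    simp only [apply_transfer] at this
    exact this
  · exact congrArg σ (Fin.ext ((hT x y hy u hx).trans hz.symm))
  · exact congrArg σ (hT' x hx)

/-! ### Counting marked permutations -/

/-- The occurrences in `σ` of members of the family `a`. -/
def occurrenceSet (a : (i : ι) → Equiv.Perm (Fin (l i))) (σ : Word) : Set (ι × ℕ) :=
  {y | OccursAt ⟨l y.1, a y.1⟩ σ y.2}

/-- The patterns of a family, as a function to words. -/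
def toWord (a : (i : ι) → Equiv.Perm (Fin (l i))) (i : ι) : Word := ⟨l i, a i⟩

theorem image_occurrenceSet (a : (i : ι) → Equiv.Perm (Fin (l i))) (σ : Word) :
    Prod.map (toWord a) id '' occurrenceSet a σ =
      {x : Word × ℕ | x.1 ∈ Set.range (toWord a) ∧ OccursAt x.1 σ x.2} := by
  ext ⟨w, p⟩
  constructor
  · rintro ⟨⟨i, p⟩, hi, h⟩
    simp only [Prod.map_apply, id, Prod.mk.injEq] at h
    obtain ⟨rfl, rfl⟩ := h
    exact ⟨⟨i, rfl⟩, hi⟩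
  · rintro ⟨⟨i, rfl⟩, hi⟩
    exact ⟨⟨i, p⟩, hi, rfl⟩

theorem finite_occurrenceSet (ha : Function.Injective (toWord a)) (σ : Word) :
    (occurrenceSet a σ).Finite := by
  refine Set.Finite.of_finite_image ?_ ((ha.prodMap Function.injective_id).injOn)
  rw [image_occurrenceSet]
  exact finite_occurrences _ σ

theorem ncard_occurrenceSet (ha : Function.Injective (toWord a)) (σ : Word) :
    (occurrenceSet a σ).ncard = occurrences (Set.range (toWord a)) σ := by
  rw [occurrences, ← image_occurrenceSet,
    Set.ncard_image_of_injective _ (ha.prodMap Function.injective_id)]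

theorem Compatible.sum_choose_le (h : Compatible a b) (ha : Function.Injective (toWord a))
    (hb : Function.Injective (toWord b)) (n m : ℕ) :
    ∑ σ : Equiv.Perm (Fin n), (occurrences (Set.range (toWord a)) ⟨n, σ⟩).choose m ≤
      ∑ σ : Equiv.Perm (Fin n), (occurrences (Set.range (toWord b)) ⟨n, σ⟩).choose m := by
  have key : ∀ c : (i : ι) → Equiv.Perm (Fin (l i)), ∀ hc : Function.Injective (toWord c),
      ∑ σ : Equiv.Perm (Fin n), (occurrences (Set.range (toWord c)) ⟨n, σ⟩).choose m =
      ((Finset.univ : Finset (Equiv.Perm (Fin n))).sigma fun σ =>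
        (finite_occurrenceSet hc ⟨n, σ⟩).toFinset.powersetCard m).card := by
    intro c hc
    rw [Finset.card_sigma]
    refine Finset.sum_congr rfl fun σ _ => ?_
    rw [Finset.card_powersetCard, ← Set.ncard_eq_toFinset_card _ (finite_occurrenceSet hc ⟨n, σ⟩),
      ncard_occurrenceSet hc]
  have hmem : ∀ c : (i : ι) → Equiv.Perm (Fin (l i)), ∀ hc : Function.Injective (toWord c),
      ∀ x : (_ : Equiv.Perm (Fin n)) × Finset (ι × ℕ),
      x ∈ ((Finset.univ : Finset (Equiv.Perm (Fin n))).sigma fun σ =>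
        (finite_occurrenceSet hc ⟨n, σ⟩).toFinset.powersetCard m) ↔
      (∀ y ∈ x.2, OccursAt ⟨l y.1, c y.1⟩ ⟨n, x.1⟩ y.2) ∧ x.2.card = m := by
    intro c hc x
    simp [Finset.mem_powersetCard, Finset.subset_iff, occurrenceSet]
  rw [key a ha, key b hb]
  -- The relation keeps the marks and rearranges the permutation: every source has an image, and no
  -- target has two sources.
  refine Finset.card_le_card_of_forall_subsingleton
    (fun x x' => x.2 = x'.2 ∧ Rearranged a b x.2 x.1 x'.1) (fun x hx => ?_) (fun x' _ => ?_)
  · obtain ⟨hx, hm⟩ := (hmem a ha x).1 hx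
    obtain ⟨σ', hσ', hr⟩ := h.exists_rearranged hx
    exact ⟨⟨σ', x.2⟩, (hmem b hb _).2 ⟨hσ', hm⟩, rfl, hr⟩
  · rintro ⟨σ₁, S₁⟩ ⟨h₁, hS₁, hr₁⟩ ⟨σ₂, S₂⟩ ⟨-, hS₂, hr₂⟩
    simp only at hS₁ hS₂ hr₁ hr₂
    subst hS₁ hS₂
    obtain rfl := hr₁.left_unique (fun y hy => (((hmem a ha _).1 h₁).1 y hy).add_le) hr₂
    rfl

end Families

/-! ### From binomial moments to the distribution, and the conclusion -/

/-- The binomial moments of a statistic on a finite type determine its distribution. -/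
theorem card_eq_of_sum_choose_eq {α : Type*} [Fintype α] {f g : α → ℕ}
    (h : ∀ m, ∑ x, (f x).choose m = ∑ x, (g x).choose m) (q : ℕ) :
    Nat.card {x // f x = q} = Nat.card {x // g x = q} := by
  classical
  open Polynomial in
  -- The binomial moments are the coefficients of the generating polynomial at `X + 1`; substituting
  -- `X - 1` for `X` recovers the polynomial itself.
  have h1 : ∑ x, (X + 1 : ℤ[X]) ^ f x = ∑ x, (X + 1 : ℤ[X]) ^ g x := by
    ext m
    simp only [finsetSum_coeff, coeff_X_add_one_pow]
    exact_mod_cast h m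
  open Polynomial in
  have h2 : ∑ x, (X : ℤ[X]) ^ f x = ∑ x, (X : ℤ[X]) ^ g x := by
    have := congrArg (fun p : ℤ[X] => p.comp (X - 1)) h1
    simpa using this
  have h3 := congrArg (fun p => Polynomial.coeff p q) h2
  simp only [Polynomial.finsetSum_coeff, Polynomial.coeff_X_pow, Finset.sum_boole,
    Nat.cast_inj] at h3
  simp only [Nat.card_eq_fintype_card, Fintype.card_subtype]
  simpa [eq_comm] using h3

/-- Both orders are read from the same stretch of `ω`. This lets the hypothesis on overlapping sets
apply to linkages. -/
theorem IsLinkage.overlaps {ω π π' : Word} (h : IsLinkage ω π π') :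
    Overlaps (π.length + π'.length - ω.length) π π' := by
  obtain ⟨hlt, hπ, hπ'⟩ := h
  have h1 := hπ.add_le
  have h2 := hπ'.add_le
  refine ⟨by omega, by omega, by omega, ?_⟩
  rw [st_eq_iff (π.subword_injective _ _ _)]
  intro u v
  have hu := u.isLt
  have hv := v.isLt
  rw [st_lt_st_iff (π'.subword_injective _ _ _)]
  have e1 := hπ.lt_iff (x := ⟨ω.length - π'.length + u, by omega⟩)
    (y := ⟨ω.length - π'.length + v, by omega⟩)
    (u := ⟨π.length - (π.length + π'.length - ω.length) + u, by omega⟩)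
    (v := ⟨π.length - (π.length + π'.length - ω.length) + v, by omega⟩)
    (by simp only; omega) (by simp only; omega)
  have e2 := hπ'.lt_iff (x := ⟨ω.length - π'.length + u, by omega⟩)
    (y := ⟨ω.length - π'.length + v, by omega⟩)
    (u := ⟨0 + u, by omega⟩) (v := ⟨0 + v, by omega⟩)
    (by simp only; omega) (by simp only; omega)
  exact e1.symm.trans e2

theorem exists_perm_eq {w : Word} {l : ℕ} (h : w.length = l) :
    ∃ π : Equiv.Perm (Fin l), (⟨l, π⟩ : Word) = w := by
  subst h
  exact ⟨w.2, rfl⟩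

end CWilf

theorem theorem1p3 (A B : Set CWilf.Word)
    (hA : CWilf.IsReduced A) (hB : CWilf.IsReduced B) (φ : A ≃ B)
    (lengths : ∀ π : A, (φ π).1.length = π.1.length)
    (linkages : ∀ (π π' : A) (n : ℕ),
      (∃ σ : CWilf.Word, σ.length = n ∧ CWilf.IsLinkage σ π π') ↔
        (∃ σ : CWilf.Word, σ.length = n ∧ CWilf.IsLinkage σ (φ π) (φ π')))
    (overlappingSets : ∀ (π π' : A) (k : ℕ), CWilf.Overlaps k π π' →
      CWilf.lastEntries π k = CWilf.lastEntries (φ π) k ∧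
        CWilf.firstEntries π' k = CWilf.firstEntries (φ π') k) :
    CWilf.StronglyCWilfEquivalent A B := by
  intro n q _
  choose b hb using fun π : A => CWilf.exists_perm_eq (lengths π)
  let a : (π : A) → Equiv.Perm (Fin π.1.length) := fun π => π.1.2
  have ha : ∀ π : A, (⟨π.1.length, a π⟩ : CWilf.Word) = π := fun π => rfl
  have hta : CWilf.toWord a = Subtype.val := rfl
  have htb : CWilf.toWord b = fun π => (φ π).1 := funext hb
  have hai : Function.Injective (CWilf.toWord a) := Subtype.val_injective
  have hbi : Function.Injective (CWilf.toWord b) := by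
    rw [htb]
    exact Subtype.val_injective.comp φ.injective
  have hra : Set.range (CWilf.toWord a) = A := by rw [hta, Subtype.range_val]
  have hrb : Set.range (CWilf.toWord b) = B := by
    rw [htb]
    exact (φ.surjective.range_comp Subtype.val).trans Subtype.range_val
  have hab : CWilf.Compatible a b := by
    constructor
    · intro i j hd
      by_contra hij
      exact hA i i.2 j j.2 (fun h => hij (Subtype.ext h)) hd
    · intro i j ω hω
      rw [hb, hb]
      exact (linkages i j _).1 ⟨ω, rfl, hω⟩
    · intro i j ω hω
      rw [hb]
      exact (overlappingSets i j _ hω.overlaps).1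
    · intro i j ω hω
      rw [hb]
      exact (overlappingSets i j _ hω.overlaps).2
  have hlink : ∀ (i j : A) (ω : CWilf.Word), CWilf.IsLinkage ω ⟨i.1.length, b i⟩ ⟨j.1.length, b j⟩ →
      ∃ ω' : CWilf.Word, ω'.length = ω.length ∧
        CWilf.IsLinkage ω' ⟨i.1.length, a i⟩ ⟨j.1.length, a j⟩ := by
    intro i j ω hω
    rw [hb, hb] at hω
    exact (linkages i j _).2 ⟨ω, rfl, hω⟩
  -- The entry sets are compared only for overlaps in the first collection; a linkage in the second
  -- is replaced by one of equal length in the first, hence with the same overlap size.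
  have hba : CWilf.Compatible b a := by
    refine ⟨fun i j hd => ?_, hlink, fun i j ω hω => ?_, fun i j ω hω => ?_⟩
    · by_contra hij
      rw [hb, hb] at hd
      exact hB _ (φ i).2 _ (φ j).2 (fun h => hij (φ.injective (Subtype.ext h))) hd
    · obtain ⟨ω', hω', h⟩ := hlink i j ω hω
      rw [← hω']
      exact (hab.last i j ω' h).symm
    · obtain ⟨ω', hω', h⟩ := hlink i j ω hω
      rw [← hω']
      exact (hab.first i j ω' h).symm
  refine CWilf.card_eq_of_sum_choose_eq (fun m => ?_) q
  have h := (hab.sum_choose_le hai hbi n m).antisymm (hba.sum_choose_le hbi hai n m)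
  rwa [hra, hrb] at h
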